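/- Identify an element $\pi$ of the hyperoctahedral group $B_n$ with the word $\pi(0)\pi(1)\cdots\pi(n)$, where $\pi(0)=0$ and $|\pi(1)|,\ldots,|\pi(n)|$ is a rearrangement of $1,\ldots,n$. It is a *signed simsun permutation* if for every $0\le k\le n$ the word obtained from $\pi(0)\pi(1)\cdots\pi(n)$ by deleting all entries of absolute value greater than $k$ contains no three consecutive letters $a>b>c$. Let ${\rm des}_B(\pi)=|\{0\le i\le n-1:\pi(i)>\pi(i+1)\}|$, and let $$R_n^{+}(x)=\sum_{\pi}x^{{\rm des}_B(\pi)},\qquad R_n^{-}(x)=\sum_{\pi}x^{{\rm des}_B(\pi)},$$ where the sums run over the signed simsun permutations of length $n$ with $\pi(1)>0$ and with $\pi(1)<0$, respectively ($R_0^+(x)=1$, $R_0^-(x)=0$). Put $$R^{\pm}(x;t)=\sum_{n\ge0}R_n^{\pm}(x)\frac{t^n}{n!},\qquad u(x,t)=t\sqrt{2x-1}-\arctan\sqrt{2x-1},\qquad p(x)=\left(\frac{\sqrt{2x}+1}{\sqrt{2x}-1}\right)^{\frac{\sqrt2}{4}},$$ $$F_1(z)=\frac{-1}{\sqrt2\,\sin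 z}\left(\frac{-\sin z}{1+\cos z}\right)^{-\frac1{\sqrt2}},\qquad F_2(z)=\frac{-1}{\sqrt2\,\sin z}\left(\frac{-\sin z}{1+\cos z}\right)^{\frac1{\sqrt2}}.$$ Then for every $x\in\mathbb{C}\setminus(-\infty,\tfrac12]$ (in particular for every real $x>\tfrac12$) and every $t\in\mathbb{C}$ with $|t|\,|\sqrt{2x-1}|<|\arctan\sqrt{2x-1}|$, both series $R^{\pm}(x;t)$ converge absolutely and, with principal values of all roots, powers and of $\arctan$, $$R^{+}(x;t)=\frac{\sqrt{2x-1}}{2\sqrt{x}\,p(x)}\left(p(x)^2F_2(u(x,t))+F_1(u(x,t))\right),$$ $$R^{-}(x;t)=\frac{-\sqrt{2x-1}}{2p(x)}\left(p(x)^2F_2(u(x,t))-F_1(u(x,t))\right).$$ -/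

import Mathlib

namespace SignedSimsun

/-- `IsSignedPerm n w`: the word `w = π(1) ⋯ π(n)` is (the window notation of) an element of the
hyperoctahedral group `B_n`, that is, a list of integers whose absolute values are `1, …, n` in
some order. -/
def IsSignedPerm (n : ℕ) (w : List ℤ) : Prop :=
  (w.map Int.natAbs).Perm (List.range' 1 n)

theorem finite_isSignedPerm (n : ℕ) : {w : List ℤ | IsSignedPerm n w}.Finite := by
  have h : {l : List (Finset.Icc (-(n : ℤ)) n) | l.length = n}.Finite :=
    List.finite_length_eq _ _
  refine (h.image (List.map Subtype.val)).subset ?_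
  intro w hw
  have hw' : (w.map Int.natAbs).Perm (List.range' 1 n) := hw
  have hmem : ∀ a ∈ w, a ∈ Finset.Icc (-(n : ℤ)) n := by
    intro a ha
    have h1 : a.natAbs ∈ List.range' 1 n := hw'.mem_iff.1 (List.mem_map_of_mem ha)
    rw [List.mem_range'_1] at h1
    rw [Finset.mem_Icc]
    omega
  refine ⟨w.attach.map (fun a => ⟨a.1, hmem a.1 a.2⟩), ?_, ?_⟩
  · have h2 := hw'.length_eq
    simpa using h2
  · simp [List.map_map, Function.comp_def]

/-- A word `v` has a double descent if it has three consecutive letters `a > b > c`. -/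
def HasDoubleDescent (v : List ℤ) : Prop :=
  ∃ a b c : ℤ, [a, b, c] <:+: v ∧ b < a ∧ c < b

/-- `w` is simsun if for every `k` the word `0 π(1) ⋯ π(n)`, with all the entries of absolute value
greater than `k` removed, has no double descent. -/
def IsSimsun (w : List ℤ) : Prop :=
  ∀ k : ℕ, ¬ HasDoubleDescent (0 :: w.filter (fun a => a.natAbs ≤ k))

/-- The type `B` descent number: the number of `i ∈ {0, …, n - 1}` with `π(i) > π(i + 1)`,
where `π(0) = 0`. -/
def desB (w : List ℤ) : ℕ :=
  ((0 :: w).zip w).countP (fun q => q.2 < q.1)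

open Classical in
/-- The set `RB_n` of signed simsun permutations of length `n`. -/
noncomputable def RB (n : ℕ) : Finset (List ℤ) :=
  (finite_isSignedPerm n).toFinset.filter IsSimsun

/-- The first letter `π(1)`, if there is one, is positive.
(The empty permutation is counted here, so that `R⁺_0 = 1` and `R⁻_0 = 0`.) -/
def FirstPos (w : List ℤ) : Prop := ∀ a ∈ w.head?, 0 < a

/-- The first letter `π(1)` exists and is negative. -/
def FirstNeg (w : List ℤ) : Prop := ∃ a ∈ w.head?, a < 0

open Classical Polynomial in
/-- `R⁺_n(x) = ∑ x ^ des_B(π)`, over the signed simsun permutations `π` with `π(1) > 0`. -/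
noncomputable def Rplus (n : ℕ) : ℕ[X] :=
  ∑ w ∈ (RB n).filter FirstPos, X ^ desB w

open Classical Polynomial in
/-- `R⁻_n(x) = ∑ x ^ des_B(π)`, over the signed simsun permutations `π` with `π(1) < 0`. -/
noncomputable def Rminus (n : ℕ) : ℕ[X] :=
  ∑ w ∈ (RB n).filter FirstNeg, X ^ desB w

/-- `u(x,t) = t √(2x-1) - arctan √(2x-1)`. -/
noncomputable def u (x t : ℂ) : ℂ :=
  t * Complex.sqrt (2 * x - 1) - Complex.arctan (Complex.sqrt (2 * x - 1))

/-- `p(x) = ((√(2x)+1)/(√(2x)-1)) ^ (√2/4)`. -/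
noncomputable def p (x : ℂ) : ℂ :=
  ((Complex.sqrt (2 * x) + 1) / (Complex.sqrt (2 * x) - 1)) ^ (Complex.sqrt 2 / 4)

/-- `F₁(z) = -1/(√2 sin z) * (-sin z/(1+cos z)) ^ (-1/√2)`. -/
noncomputable def F₁ (z : ℂ) : ℂ :=
  -1 / (Complex.sqrt 2 * Complex.sin z) *
    (-Complex.sin z / (1 + Complex.cos z)) ^ (-(1 / Complex.sqrt 2))

/-- `F₂(z) = -1/(√2 sin z) * (-sin z/(1+cos z)) ^ (1/√2)`. -/
noncomputable def F₂ (z : ℂ) : ℂ :=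
  -1 / (Complex.sqrt 2 * Complex.sin z) *
    (-Complex.sin z / (1 + Complex.cos z)) ^ (1 / Complex.sqrt 2)

end SignedSimsun

namespace SignedSimsun

/-! ### Descents and double descents of words -/

/-! A signed simsun permutation of length `n + 1` is one of length `n` with `n + 1` or `-(n + 1)`
inserted so that no double descent arises. Counting the admissible slots by their effect on the
descent number (`insertSum_max`, `insertSum_min`), and tracking the sign of the first letter, gives
the coupled recurrences `RplusC_succ` and `RminusC_succ`.

These recurrences are those of repeated differentiation. Let P(s) = tan(s/2)^c / sin s with 2c² = 1,
Q = -2c cos s · P and X = 1/(2 cos² s). Then P' = -cot s (P + XQ), Q' = -cot s (P + 2XQ), X' = -cot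
s · 2X(1 - 2X), and (cot s)' = -cot² s · 2X. By induction the n-th derivative of P is (-cot s)^n
(R⁺_n(X) P + R⁻_n(X) Q) (`hasDerivAt_kernelDeriv`).

Put y = √(2x-1) and α = arctan y. At s = α one has X = x and y cot α = 1, so the Taylor series of t
↦ P(α - ty) is the generating function of R⁺_n(x) P(α) + R⁻_n(x) Q(α) (`hasSum_kernelP`). The
choices c = ±1/√2 give two linear equations, which are solved for R⁺ and R⁻. The series converges
because the disc |s - α| < |α| meets the real axis inside (0, π), so tan(s/2) avoids the branch cut
there (`halfTan_mem_slitPlane_of_norm_sub_lt`). It remains to match principal values: `p_eq`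
identifies p(x) with tan(α/2)^(-1/√2). -/

/-- The number of descents of a word. -/
def desc (L : List ℤ) : ℕ := (L.zip L.tail).countP (fun q => q.2 < q.1)

theorem desB_eq_desc (w : List ℤ) : desB w = desc (0 :: w) := rfl

@[simp] theorem desc_singleton (a : ℤ) : desc [a] = 0 := rfl

theorem desc_cons_cons (a b : ℤ) (l : List ℤ) :
    desc (a :: b :: l) = desc (b :: l) + if b < a then 1 else 0 := by
  simp [desc, List.countP_cons]

theorem hasDoubleDescent_cons (a : ℤ) (l : List ℤ) :
    HasDoubleDescent (a :: l) ↔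
      (∃ b c t, l = b :: c :: t ∧ b < a ∧ c < b) ∨ HasDoubleDescent l := by
  constructor
  · rintro ⟨a', b, c, h, hab, hbc⟩
    rcases List.infix_cons_iff.1 h with h | h
    · obtain ⟨t, ht⟩ := h
      simp only [List.cons_append, List.nil_append, List.cons.injEq] at ht
      exact Or.inl ⟨b, c, t, ht.2.symm, ht.1 ▸ hab, hbc⟩
    · exact Or.inr ⟨a', b, c, h, hab, hbc⟩
  · rintro (⟨b, c, t, rfl, hab, hbc⟩ | ⟨a', b, c, h, hab, hbc⟩)
    · exact ⟨a, b, c, ⟨[], t, rfl⟩, hab, hbc⟩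
    · exact ⟨a', b, c, List.infix_cons_iff.2 (Or.inr h), hab, hbc⟩

@[simp] theorem not_hasDoubleDescent_nil : ¬ HasDoubleDescent [] := by
  rintro ⟨a, b, c, h, -⟩
  simp at h

@[simp] theorem not_hasDoubleDescent_singleton (a : ℤ) : ¬ HasDoubleDescent [a] := by
  simp [hasDoubleDescent_cons]

@[simp] theorem not_hasDoubleDescent_pair (a b : ℤ) : ¬ HasDoubleDescent [a, b] := by
  simp [hasDoubleDescent_cons]

theorem hasDoubleDescent_cons_cons_cons (a b c : ℤ) (l : List ℤ) :
    HasDoubleDescent (a :: b :: c :: l) ↔ (b < a ∧ c < b) ∨ HasDoubleDescent (b :: c :: l) := by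
  rw [hasDoubleDescent_cons]
  simp

variable {A : Type*} [CommRing A]

open Classical in
/-- The weight `x ^ des` of a word without double descent, and `0` for the other words. -/
noncomputable def weight (x : A) (L : List ℤ) : A :=
  if HasDoubleDescent L then 0 else x ^ desc L

theorem weight_of_not {L : List ℤ} (x : A) (h : ¬ HasDoubleDescent L) :
    weight x L = x ^ desc L := if_neg h

theorem weight_of_hasDoubleDescent {L : List ℤ} (x : A) (h : HasDoubleDescent L) :
    weight x L = 0 := if_pos h

@[simp] theorem weight_singleton (x : A) (a : ℤ) : weight x [a] = 1 := by
  simp [weight]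

theorem weight_cons_of_not_lt (x : A) {a b : ℤ} (l : List ℤ) (h : ¬ b < a) :
    weight x (a :: b :: l) = weight x (b :: l) := by
  have : HasDoubleDescent (a :: b :: l) ↔ HasDoubleDescent (b :: l) := by
    cases l with
    | nil => simp
    | cons c l => simp [hasDoubleDescent_cons_cons_cons, h]
  by_cases hd : HasDoubleDescent (b :: l)
  · rw [weight_of_hasDoubleDescent x hd, weight_of_hasDoubleDescent x (this.2 hd)]
  · rw [weight_of_not x hd, weight_of_not x (mt this.1 hd), desc_cons_cons, if_neg h, add_zero]

theorem weight_cons_of_lt (x : A) {a b : ℤ} {l : List ℤ} (h : b < a)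
    (hl : ∀ c ∈ l.head?, ¬ c < b) :
    weight x (a :: b :: l) = x * weight x (b :: l) := by
  have : HasDoubleDescent (a :: b :: l) ↔ HasDoubleDescent (b :: l) := by
    cases l with
    | nil => simp
    | cons c l =>
      have := hl c (by simp)
      simp [hasDoubleDescent_cons_cons_cons, this]
  by_cases hd : HasDoubleDescent (b :: l)
  · simp [weight, this, hd]
  · simp [weight, this, hd, desc_cons_cons, h, pow_succ, mul_comm]

theorem weight_cons_cons_eq_zero (x : A) {a b c : ℤ} (l : List ℤ) (h : b < a) (h' : c < b) :
    weight x (a :: b :: c :: l) = 0 :=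
  weight_of_hasDoubleDescent x ((hasDoubleDescent_cons_cons_cons _ _ _ _).2 (Or.inl ⟨h, h'⟩))

/-! ### Inserting an extremal letter -/

theorem permutations'Aux_eq_cons {α : Type*} (t : α) (l : List α) :
    List.permutations'Aux t l = (t :: l) :: (List.permutations'Aux t l).tail := by
  cases l <;> simp [List.permutations'Aux]

theorem head?_of_mem_tail_permutations'Aux {α : Type*} {t : α} {l v : List α}
    (hv : v ∈ (List.permutations'Aux t l).tail) : v.head? = l.head? := by
  cases l with
  | nil => simp [List.permutations'Aux] at hv
  | cons b l =>
    simp only [List.permutations'Aux, List.tail_cons, List.mem_map] at hv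
    obtain ⟨v', -, rfl⟩ := hv
    rfl

/-- The total weight of the words obtained from `a :: l` by inserting `m` after the first letter. -/
noncomputable def insertSum (x : A) (m a : ℤ) (l : List ℤ) : A :=
  ((List.permutations'Aux m l).map (fun v => weight x (a :: v))).sum

theorem insertSum_nil (x : A) (m a : ℤ) : insertSum x m a [] = weight x [a, m] := by
  simp [insertSum, List.permutations'Aux]

theorem insertSum_cons (x : A) (m a b : ℤ) (l : List ℤ) :
    insertSum x m a (b :: l) = weight x (a :: m :: b :: l) +
      ((List.permutations'Aux m l).map (fun v => weight x (a :: b :: v))).sum := by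
  simp [insertSum, List.permutations'Aux, Function.comp_def]

theorem insertSum_cons_of_not_lt (x : A) (m : ℤ) {a b : ℤ} (l : List ℤ) (h : ¬ b < a) :
    insertSum x m a (b :: l) = weight x (a :: m :: b :: l) + insertSum x m b l := by
  rw [insertSum_cons]
  simp only [insertSum, weight_cons_of_not_lt x _ h]

/-- The tail of the insertion list leaves out the word with `m` in front, so the letter following
`b` is still the first letter of `l`, and prefixing `a > b` costs exactly one factor `x`. -/
theorem tail_sum_of_lt (x : A) (m : ℤ) {a b : ℤ} {l : List ℤ} (h : b < a)
    (hl : ∀ c ∈ l.head?, ¬ c < b) :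
    ((List.permutations'Aux m l).tail.map (fun v => weight x (a :: b :: v))).sum =
      x * ((List.permutations'Aux m l).tail.map (fun v => weight x (b :: v))).sum := by
  rw [← List.sum_map_mul_left]
  congr 1
  refine List.map_congr_left fun v hv => weight_cons_of_lt x h ?_
  rwa [head?_of_mem_tail_permutations'Aux hv]

theorem not_lt_head_of_lt {a b : ℤ} {l : List ℤ} (hd : ¬ HasDoubleDescent (a :: b :: l))
    (h : b < a) : ∀ c ∈ l.head?, ¬ c < b := by
  cases l with
  | nil => simp
  | cons c l =>
    rw [hasDoubleDescent_cons_cons_cons] at hd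
    simp only [List.head?_cons, Option.mem_def, Option.some.injEq, forall_eq']
    exact fun hc => hd (Or.inl ⟨h, hc⟩)

theorem not_hasDoubleDescent_of_cons {a : ℤ} {l : List ℤ} (h : ¬ HasDoubleDescent (a :: l)) :
    ¬ HasDoubleDescent l := fun h' => h ((hasDoubleDescent_cons _ _).2 (Or.inr h'))

open Classical in
/-- `1` if the word `a :: l` starts with a descent and `0` otherwise. -/
noncomputable def startDesc (a : ℤ) (l : List ℤ) : ℕ := if ∃ b ∈ l.head?, b < a then 1 else 0

theorem desc_cons (a : ℤ) (l : List ℤ) : desc (a :: l) = desc l + startDesc a l := by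
  cases l with
  | nil => simp [startDesc, desc]
  | cons b l => simp [desc_cons_cons, startDesc]

theorem startDesc_eq_zero {b : ℤ} {l : List ℤ} (h : ∀ c ∈ l.head?, ¬ c < b) :
    startDesc b l = 0 := by
  unfold startDesc
  rw [if_neg]
  rintro ⟨c, hc, hcb⟩
  exact h c hc hcb

/-- A maximum placed inside a descent, or at the end, keeps the descent number: `desc + 1` slots.
Inside an ascent it adds a descent, and is admissible unless that ascent is followed by a descent.
Every descent is preceded by an ascent except one that starts the word, so `desc - startDesc` of the
`length - desc` ascents are excluded. -/
theorem insertSum_max (x : A) (m : ℤ) (l : List ℤ) (a : ℤ) (hm : ∀ b ∈ a :: l, b < m)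
    (hd : ¬ HasDoubleDescent (a :: l)) :
    insertSum x m a l = ((desc (a :: l) : A) + 1) * x ^ desc (a :: l) +
      ((l.length : A) - 2 * (desc (a :: l) : A) + (startDesc a l : A)) *
        x ^ (desc (a :: l) + 1) := by
  induction l generalizing a with
  | nil =>
    have ha : a < m := hm a (by simp)
    rw [insertSum_nil, weight_cons_of_not_lt x _ (by lia)]
    simp [startDesc]
  | cons b l ih =>
    have ham : a < m := hm a (by simp)
    have hbm : b < m := hm b (by simp)
    have hd' := not_hasDoubleDescent_of_cons hd
    have ih := ih b (fun c hc => hm c (List.mem_cons_of_mem _ hc)) hd'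
    have hw : weight x (a :: m :: b :: l) = weight x (m :: b :: l) :=
      weight_cons_of_not_lt x _ (by lia)
    by_cases h : b < a
    · have hl := not_lt_head_of_lt hd h
      have h0 : startDesc b l = 0 := startDesc_eq_zero hl
      have h1 : startDesc a (b :: l) = 1 := by simp [startDesc, h]
      rw [h0] at ih
      rw [insertSum_cons, hw, weight_cons_of_lt x hbm hl, weight_of_not x hd',
        desc_cons a (b :: l), h1]
      have key : ((List.permutations'Aux m l).map (fun v => weight x (a :: b :: v))).sum =
          x * insertSum x m b l := by
        rw [insertSum, permutations'Aux_eq_cons]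
        simp only [List.map_cons, List.sum_cons, mul_add]
        rw [tail_sum_of_lt x m h hl, weight_cons_of_lt x h]
        simp [hbm.le]
      rw [key, ih]
      push_cast [List.length_cons]
      ring
    · have h1 : startDesc a (b :: l) = 0 := by simp [startDesc, not_lt.1 h]
      rw [insertSum_cons_of_not_lt x m l h, hw, ih, desc_cons a (b :: l), h1]
      -- Insertion into the ascent before `b` is forbidden exactly when `b` starts a descent.
      have key : weight x (m :: b :: l) = (1 - (startDesc b l : A)) * x ^ (desc (b :: l) + 1) := by
        by_cases hl : ∀ c ∈ l.head?, ¬ c < b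
        · rw [weight_cons_of_lt x hbm hl, weight_of_not x hd', startDesc_eq_zero hl]
          ring
        · push Not at hl
          obtain ⟨c, hc, hcb⟩ := hl
          cases l with
          | nil => simp at hc
          | cons c' l =>
            obtain rfl : c' = c := by simpa using hc
            rw [weight_cons_cons_eq_zero x l hbm hcb]
            simp [startDesc, hcb]
      rw [key]
      push_cast [List.length_cons]
      ring

/-- A minimum placed inside a descent keeps the descent number. In an ascent or at the end it adds a
descent, and is admissible unless the letter on its left is the bottom of a descent. Each descent
bottom spoils exactly one of these `length + 1 - desc` slots. -/
theorem insertSum_min (x : A) (m : ℤ) (l : List ℤ) (a : ℤ) (hm : ∀ b ∈ a :: l, m < b)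
    (hd : ¬ HasDoubleDescent (a :: l)) :
    insertSum x m a l = (desc (a :: l) : A) * x ^ desc (a :: l) +
      ((l.length : A) + 1 - 2 * (desc (a :: l) : A)) * x ^ (desc (a :: l) + 1) := by
  induction l generalizing a with
  | nil =>
    have ha : m < a := hm a (by simp)
    rw [insertSum_nil, weight_cons_of_lt x ha (by simp)]
    simp
  | cons b l ih =>
    have ham : m < a := hm a (by simp)
    have hbm : m < b := hm b (by simp)
    have hd' := not_hasDoubleDescent_of_cons hd
    have ih := ih b (fun c hc => hm c (List.mem_cons_of_mem _ hc)) hd'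
    have hw : weight x (a :: m :: b :: l) = x * x ^ desc (b :: l) := by
      rw [weight_cons_of_lt x ham (by simp [hbm.le]), weight_cons_of_not_lt x _ (by lia),
        weight_of_not x hd']
    by_cases h : b < a
    · have hl := not_lt_head_of_lt hd h
      have h0 : startDesc b l = 0 := startDesc_eq_zero hl
      have h1 : startDesc a (b :: l) = 1 := by simp [startDesc, h]
      rw [insertSum_cons, hw, desc_cons a (b :: l), h1]
      have hml : weight x (b :: m :: l) = x * x ^ desc (b :: l) := by
        have hlm : ∀ c ∈ l.head?, ¬ c < m := fun c hc =>
          (hm c (by simp [List.mem_of_mem_head? hc])).le.not_gt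
        rw [weight_cons_of_lt x hbm hlm, desc_cons, h0]
        have : ¬ HasDoubleDescent (m :: l) := by
          rw [hasDoubleDescent_cons]
          rintro (⟨c, c', t, rfl, hc, -⟩ | hl')
          · exact hlm c (by simp) hc
          · exact not_hasDoubleDescent_of_cons hd' hl'
        rw [weight_of_not x this, desc_cons, startDesc_eq_zero hlm]
      -- The slot right after `b` is lost, since it would create `a > b > m`; its contribution is
      -- therefore subtracted.
      have key : ((List.permutations'Aux m l).map (fun v => weight x (a :: b :: v))).sum =
          x * (insertSum x m b l - weight x (b :: m :: l)) := by
        rw [insertSum, permutations'Aux_eq_cons]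
        simp only [List.map_cons, List.sum_cons]
        rw [tail_sum_of_lt x m h hl, weight_cons_cons_eq_zero x l h hbm]
        ring
      rw [key, ih, hml]
      push_cast [List.length_cons]
      ring
    · have h1 : startDesc a (b :: l) = 0 := by simp [startDesc, not_lt.1 h]
      rw [insertSum_cons_of_not_lt x m l h, hw, ih, desc_cons a (b :: l), h1]
      push_cast [List.length_cons]
      ring

end SignedSimsun

namespace SignedSimsun

/-! ### Signed simsun permutations of length `n + 1` by insertion -/

theorem mem_permutations'Aux_iff {α : Type*} {t : α} {l v : List α} :
    v ∈ List.permutations'Aux t l ↔ ∃ l₁ l₂, l = l₁ ++ l₂ ∧ v = l₁ ++ t :: l₂ := by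
  induction l generalizing v with
  | nil => simp [List.permutations'Aux]
  | cons b l ih =>
    simp only [List.permutations'Aux, List.mem_cons, List.mem_map, ih]
    constructor
    · rintro (rfl | ⟨v', ⟨l₁, l₂, rfl, rfl⟩, rfl⟩)
      · exact ⟨[], b :: l, rfl, rfl⟩
      · exact ⟨b :: l₁, l₂, rfl, rfl⟩
    · rintro ⟨l₁, l₂, h, rfl⟩
      cases l₁ with
      | nil => exact Or.inl (by simp_all)
      | cons c l₁ =>
        simp only [List.cons_append, List.cons.injEq] at h
        exact Or.inr ⟨l₁ ++ t :: l₂, ⟨l₁, l₂, h.2, rfl⟩, by simp [h.1]⟩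

theorem mem_RB {n : ℕ} {w : List ℤ} : w ∈ RB n ↔ IsSignedPerm n w ∧ IsSimsun w := by
  simp [RB]

namespace IsSignedPerm

variable {n : ℕ} {w : List ℤ}

theorem mem_natAbs (h : IsSignedPerm n w) {a : ℤ} (ha : a ∈ w) : 1 ≤ a.natAbs ∧ a.natAbs ≤ n := by
  have h1 : a.natAbs ∈ List.range' 1 n := h.mem_iff.1 (List.mem_map_of_mem ha)
  rw [List.mem_range'_1] at h1
  lia

theorem length_eq (h : IsSignedPerm n w) : w.length = n := by
  simpa using List.Perm.length_eq h

theorem filter_eq_self (h : IsSignedPerm n w) {k : ℕ} (hk : n ≤ k) :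
    w.filter (fun a => a.natAbs ≤ k) = w := by
  rw [List.filter_eq_self]
  intro a ha
  have := (h.mem_natAbs ha).2
  simpa using this.trans hk

theorem append_cons_iff {m : ℤ} (hm : m.natAbs = n + 1) {l₁ l₂ : List ℤ} :
    IsSignedPerm (n + 1) (l₁ ++ m :: l₂) ↔ IsSignedPerm n (l₁ ++ l₂) := by
  unfold IsSignedPerm
  rw [List.range'_1_concat, ((List.perm_middle (a := m) (l₁ := l₁) (l₂ := l₂)).map
    Int.natAbs).congr_left, List.perm_append_singleton _ _ |>.congr_right, List.map_cons, hm,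
    add_comm 1 n, List.perm_cons]

end IsSignedPerm

theorem filter_append_cons {n k : ℕ} {m : ℤ} (hm : m.natAbs = n + 1) (hk : k ≤ n)
    (l₁ l₂ : List ℤ) :
    (l₁ ++ m :: l₂).filter (fun a => a.natAbs ≤ k) =
      (l₁ ++ l₂).filter (fun a => a.natAbs ≤ k) := by
  have : ¬ m.natAbs ≤ k := by lia
  simp [this]

theorem IsSimsun.not_hasDoubleDescent {n : ℕ} {w : List ℤ} (h : IsSimsun w)
    (hw : IsSignedPerm n w) : ¬ HasDoubleDescent (0 :: w) := by
  have := h n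
  rwa [hw.filter_eq_self le_rfl] at this

/-- The restrictions to `k ≤ n` do not see `m`, and for `k > n` nothing is deleted, so the only new
condition concerns the full word. -/
theorem append_cons_mem_RB_iff {n : ℕ} {m : ℤ} (hm : m.natAbs = n + 1) {l₁ l₂ : List ℤ} :
    l₁ ++ m :: l₂ ∈ RB (n + 1) ↔
      l₁ ++ l₂ ∈ RB n ∧ ¬ HasDoubleDescent (0 :: (l₁ ++ m :: l₂)) := by
  rw [mem_RB, mem_RB, IsSignedPerm.append_cons_iff hm]
  constructor
  · rintro ⟨h, hs⟩
    refine ⟨⟨h, fun k => ?_⟩, hs.not_hasDoubleDescent ((IsSignedPerm.append_cons_iff hm).2 h)⟩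
    rcases le_or_gt k n with hk | hk
    · have := hs k
      rwa [filter_append_cons hm hk] at this
    · have := hs n
      rwa [filter_append_cons hm le_rfl, h.filter_eq_self le_rfl,
        ← h.filter_eq_self hk.le] at this
  · rintro ⟨⟨h, hs⟩, hd⟩
    refine ⟨h, fun k => ?_⟩
    rcases le_or_gt k n with hk | hk
    · rw [filter_append_cons hm hk]
      exact hs k
    · rwa [((IsSignedPerm.append_cons_iff hm).2 h).filter_eq_self hk]

theorem exists_append_cons_of_mem_RB {n : ℕ} {v : List ℤ} (hv : v ∈ RB (n + 1)) :
    ∃ (m : ℤ) (l₁ l₂ : List ℤ), m.natAbs = n + 1 ∧ v = l₁ ++ m :: l₂ := by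
  have h := (mem_RB.1 hv).1
  have : n + 1 ∈ v.map Int.natAbs := h.mem_iff.2 (by simp [List.mem_range'_1])
  obtain ⟨m, hm, hmn⟩ := List.mem_map.1 this
  obtain ⟨l₁, l₂, rfl⟩ := List.append_of_mem hm
  exact ⟨m, l₁, l₂, hmn, rfl⟩

/-- The words obtained from `w` by inserting `n + 1` or `-(n + 1)`. -/
def insertions (n : ℕ) (w : List ℤ) : List (List ℤ) :=
  List.permutations'Aux ((n : ℤ) + 1) w ++ List.permutations'Aux (-((n : ℤ) + 1)) w

theorem mem_insertions {n : ℕ} {w v : List ℤ} :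
    v ∈ insertions n w ↔
      ∃ (m : ℤ) (l₁ l₂ : List ℤ), m.natAbs = n + 1 ∧ w = l₁ ++ l₂ ∧ v = l₁ ++ m :: l₂ := by
  rw [insertions, List.mem_append, mem_permutations'Aux_iff, mem_permutations'Aux_iff]
  constructor
  · rintro (⟨l₁, l₂, h⟩ | ⟨l₁, l₂, h⟩)
    · exact ⟨_, l₁, l₂, by lia, h⟩
    · exact ⟨_, l₁, l₂, by lia, h⟩
  · rintro ⟨m, l₁, l₂, hm, h⟩
    rcases (by lia : m = (n : ℤ) + 1 ∨ m = -((n : ℤ) + 1)) with rfl | rfl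
    · exact Or.inl ⟨l₁, l₂, h⟩
    · exact Or.inr ⟨l₁, l₂, h⟩

theorem nodup_insertions {n : ℕ} {w : List ℤ} (hw : IsSignedPerm n w) :
    (insertions n w).Nodup := by
  have h1 : ((n : ℤ) + 1) ∉ w := fun h => by have := (hw.mem_natAbs h).2; lia
  have h2 : (-((n : ℤ) + 1)) ∉ w := fun h => by have := (hw.mem_natAbs h).2; lia
  refine List.Nodup.append (List.nodup_permutations'Aux_of_notMem _ _ h1)
    (List.nodup_permutations'Aux_of_notMem _ _ h2) ?_
  intro v hv hv'
  obtain ⟨l₁, l₂, rfl, rfl⟩ := mem_permutations'Aux_iff.1 hv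
  obtain ⟨l₁', l₂', h, h'⟩ := mem_permutations'Aux_iff.1 hv'
  have : ((n : ℤ) + 1) ∈ l₁' ++ -((n : ℤ) + 1) :: l₂' := h' ▸ by simp
  have h3 : ((n : ℤ) + 1) ∈ l₁' ++ l₂' := by
    simp only [List.mem_append, List.mem_cons] at this ⊢
    rcases this with h | h | h
    · exact Or.inl h
    · lia
    · exact Or.inr h
  exact h1 (h ▸ h3)

variable {A : Type*} [CommRing A]

-- Deleting the letter of largest absolute value maps `RB (n + 1)` to `RB n`. The fibre over `w`
-- consists of the insertions without double descent; as `weight` vanishes on the others, the sum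
-- may run over all insertions.
open Classical in
theorem sum_RB_succ (n : ℕ) (x : A) (q : List ℤ → Prop) :
    ∑ v ∈ (RB (n + 1)).filter q, x ^ desB v =
      ∑ w ∈ RB n, ((insertions n w).map
        (fun v => if q v then weight x (0 :: v) else 0)).sum := by
  have hmaps : ∀ v ∈ RB (n + 1), v.filter (fun a => a.natAbs ≤ n) ∈ RB n := by
    intro v hv
    obtain ⟨m, l₁, l₂, hm, rfl⟩ := exists_append_cons_of_mem_RB hv
    have h := ((append_cons_mem_RB_iff hm).1 hv).1
    rwa [filter_append_cons hm le_rfl, (mem_RB.1 h).1.filter_eq_self le_rfl]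
  rw [Finset.sum_filter, ← Finset.sum_fiberwise_of_maps_to hmaps]
  refine Finset.sum_congr rfl fun w hw => ?_
  have hwp := (mem_RB.1 hw).1
  rw [← List.sum_toFinset _ (nodup_insertions hwp)]
  have hsub : (RB (n + 1)).filter (fun v => v.filter (fun a => a.natAbs ≤ n) = w) ⊆
      (insertions n w).toFinset := by
    intro v hv
    rw [Finset.mem_filter] at hv
    obtain ⟨hv, hvw⟩ := hv
    obtain ⟨m, l₁, l₂, hm, rfl⟩ := exists_append_cons_of_mem_RB hv
    have h := ((append_cons_mem_RB_iff hm).1 hv).1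
    rw [filter_append_cons hm le_rfl, (mem_RB.1 h).1.filter_eq_self le_rfl] at hvw
    rw [List.mem_toFinset, mem_insertions]
    exact ⟨m, l₁, l₂, hm, hvw.symm, rfl⟩
  have hmem : ∀ v ∈ insertions n w, (v ∈ (RB (n + 1)).filter
      (fun v => v.filter (fun a => a.natAbs ≤ n) = w) ↔ ¬ HasDoubleDescent (0 :: v)) := by
    intro v hv
    obtain ⟨m, l₁, l₂, hm, rfl, rfl⟩ := mem_insertions.1 hv
    rw [Finset.mem_filter, append_cons_mem_RB_iff hm, filter_append_cons hm le_rfl,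
      hwp.filter_eq_self le_rfl]
    tauto
  refine Eq.trans (Finset.sum_congr rfl fun v hv => ?_)
    (Finset.sum_subset hsub fun v hv hv' => ?_)
  · have := (hmem v (List.mem_toFinset.1 (hsub hv))).1 hv
    rw [weight_of_not x this, desB_eq_desc]
  · have := (hmem v (List.mem_toFinset.1 hv)).not.1 hv'
    rw [weight_of_hasDoubleDescent x (not_not.1 this), ite_self]

theorem firstNeg_iff_not_firstPos {n : ℕ} {w : List ℤ} (hw : IsSignedPerm n w) :
    FirstNeg w ↔ ¬ FirstPos w := by
  cases w with
  | nil => simp [FirstNeg, FirstPos]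
  | cons a w =>
    have := (hw.mem_natAbs (a := a) (by simp)).1
    simp only [FirstNeg, FirstPos, List.head?_cons, Option.mem_def, Option.some.injEq,
      exists_eq_left', forall_eq']
    lia

theorem firstPos_congr {v w : List ℤ} (h : v.head? = w.head?) : FirstPos v ↔ FirstPos w := by
  simp [FirstPos, h]

theorem firstNeg_congr {v w : List ℤ} (h : v.head? = w.head?) : FirstNeg v ↔ FirstNeg w := by
  simp [FirstNeg, h]

/-- A word property depending only on the first letter splits the sum over insertions. -/
theorem sum_permutations'Aux_ite (x : A) (m : ℤ) (w : List ℤ) (q : List ℤ → Prop)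
    [DecidablePred q] (hq : ∀ v : List ℤ, v.head? = w.head? → (q v ↔ q w)) :
    ((List.permutations'Aux m w).map (fun v => if q v then weight x (0 :: v) else 0)).sum =
      (if q (m :: w) then weight x (0 :: m :: w) else 0) +
        if q w then insertSum x m 0 w - weight x (0 :: m :: w) else 0 := by
  have h1 : (List.permutations'Aux m w).tail.map
      (fun v => if q v then weight x (0 :: v) else 0) = (List.permutations'Aux m w).tail.map
      (fun v => if q w then weight x (0 :: v) else 0) :=
    List.map_congr_left fun v hv => by
      simp only [hq v (head?_of_mem_tail_permutations'Aux hv)]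
  have h2 : insertSum x m 0 w = weight x (0 :: m :: w) +
      ((List.permutations'Aux m w).tail.map (fun v => weight x (0 :: v))).sum := by
    rw [insertSum]
    conv_lhs => rw [permutations'Aux_eq_cons]
    simp
  rw [h2, permutations'Aux_eq_cons]
  simp only [List.map_cons, List.sum_cons, List.tail_cons, h1]
  by_cases h : q w <;> simp [h]

end SignedSimsun

namespace SignedSimsun

/-! ### The recurrence for `R⁺` and `R⁻` -/

section

variable {A : Type*} [CommRing A] {n : ℕ} {w : List ℤ}

theorem insertSum_max_of_mem_RB (hw : w ∈ RB n) (x : A) :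
    insertSum x ((n : ℤ) + 1) 0 w = ((desB w : A) + 1) * x ^ desB w +
      ((n : A) - 2 * (desB w : A) + (startDesc 0 w : A)) * x ^ (desB w + 1) := by
  obtain ⟨hp, hs⟩ := mem_RB.1 hw
  rw [insertSum_max x _ w 0 _ (hs.not_hasDoubleDescent hp), hp.length_eq, desB_eq_desc]
  intro b hb
  rcases List.mem_cons.1 hb with rfl | hb
  · lia
  · have := (hp.mem_natAbs hb).2
    lia

theorem insertSum_min_of_mem_RB (hw : w ∈ RB n) (x : A) :
    insertSum x (-((n : ℤ) + 1)) 0 w = (desB w : A) * x ^ desB w +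
      ((n : A) + 1 - 2 * (desB w : A)) * x ^ (desB w + 1) := by
  obtain ⟨hp, hs⟩ := mem_RB.1 hw
  rw [insertSum_min x _ w 0 _ (hs.not_hasDoubleDescent hp), hp.length_eq, desB_eq_desc]
  intro b hb
  rcases List.mem_cons.1 hb with rfl | hb
  · lia
  · have := (hp.mem_natAbs hb).2
    lia

theorem firstPos_cons_max (n : ℕ) (w : List ℤ) : FirstPos (((n : ℤ) + 1) :: w) := by
  simp only [FirstPos, List.head?_cons, Option.mem_def, Option.some.injEq, forall_eq']
  lia

theorem not_firstPos_cons_min (n : ℕ) (w : List ℤ) : ¬ FirstPos ((-((n : ℤ) + 1)) :: w) := by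
  simp only [FirstPos, List.head?_cons, Option.mem_def, Option.some.injEq, forall_eq']
  lia

theorem not_firstNeg_cons_max (n : ℕ) (w : List ℤ) : ¬ FirstNeg (((n : ℤ) + 1) :: w) := by
  simp only [FirstNeg, List.head?_cons, Option.mem_def, Option.some.injEq, exists_eq_left']
  lia

theorem firstNeg_cons_min (n : ℕ) (w : List ℤ) : FirstNeg ((-((n : ℤ) + 1)) :: w) := by
  simp only [FirstNeg, List.head?_cons, Option.mem_def, Option.some.injEq, exists_eq_left']
  lia

theorem startDesc_zero_of_firstPos (h : FirstPos w) : startDesc 0 w = 0 :=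
  startDesc_eq_zero fun c hc => (h c hc).le.not_gt

theorem startDesc_zero_of_firstNeg (h : FirstNeg w) : startDesc 0 w = 1 := if_pos h

theorem weight_cons_min (hw : w ∈ RB n) (h : FirstPos w) (x : A) :
    weight x (0 :: (-((n : ℤ) + 1)) :: w) = x ^ (desB w + 1) := by
  obtain ⟨hp, hs⟩ := mem_RB.1 hw
  have hd := not_hasDoubleDescent_of_cons (hs.not_hasDoubleDescent hp)
  have hm : ∀ c ∈ w.head?, ¬ c < -((n : ℤ) + 1) := fun c hc => by
    have := (hp.mem_natAbs (List.mem_of_mem_head? hc)).2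
    lia
  rw [weight_cons_of_lt x (by lia) hm, desB_eq_desc, desc_cons, startDesc_zero_of_firstPos h,
    add_zero, pow_succ']
  cases w with
  | nil => simp [desc]
  | cons b l =>
    rw [weight_cons_of_not_lt x _ (hm b (by simp)), weight_of_not x hd]

/-- The initial descent `0 > π(1)` is merely replaced by `n + 1 > π(1)`. -/
theorem weight_cons_max (hw : w ∈ RB n) (h : FirstNeg w) (x : A) :
    weight x (0 :: ((n : ℤ) + 1) :: w) = x ^ desB w := by
  obtain ⟨hp, hs⟩ := mem_RB.1 hw
  have hd := hs.not_hasDoubleDescent hp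
  rw [weight_cons_of_not_lt x _ (by lia), desB_eq_desc, desc_cons, startDesc_zero_of_firstNeg h]
  cases w with
  | nil => simp [FirstNeg] at h
  | cons b l =>
    have hb : b < 0 := by simpa [FirstNeg] using h
    rw [weight_cons_of_lt x (by lia) (not_lt_head_of_lt hd hb),
      weight_of_not x (not_hasDoubleDescent_of_cons hd), pow_succ']

-- If `π(1) > 0`, every insertion keeps the sign of the first letter except `-(n + 1)` in front. If
-- `π(1) < 0`, only `n + 1` in front makes it positive.
open Classical in
theorem sum_insertions_firstPos (hw : w ∈ RB n) (x : A) :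
    ((insertions n w).map (fun v => if FirstPos v then weight x (0 :: v) else 0)).sum =
      if FirstPos w then (2 * (desB w : A) + 1) * x ^ desB w +
        2 * ((n : A) - 2 * (desB w : A)) * x ^ (desB w + 1) else x ^ desB w := by
  rw [insertions, List.map_append, List.sum_append,
    sum_permutations'Aux_ite x _ w _ fun v => firstPos_congr,
    sum_permutations'Aux_ite x _ w _ fun v => firstPos_congr,
    if_pos (firstPos_cons_max n w), if_neg (not_firstPos_cons_min n w)]
  by_cases h : FirstPos w
  · simp only [if_pos h]
    rw [weight_cons_min hw h, insertSum_max_of_mem_RB hw, insertSum_min_of_mem_RB hw,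
      startDesc_zero_of_firstPos h]
    push_cast
    ring
  · have h' := (firstNeg_iff_not_firstPos (mem_RB.1 hw).1).2 h
    simp only [if_neg h, weight_cons_max hw h', add_zero]

open Classical in
theorem sum_insertions_firstNeg (hw : w ∈ RB n) (x : A) :
    ((insertions n w).map (fun v => if FirstNeg v then weight x (0 :: v) else 0)).sum =
      if FirstPos w then x ^ (desB w + 1) else 2 * (desB w : A) * x ^ desB w +
        2 * ((n : A) + 1 - 2 * (desB w : A)) * x ^ (desB w + 1) := by
  rw [insertions, List.map_append, List.sum_append,
    sum_permutations'Aux_ite x _ w _ fun v => firstNeg_congr,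
    sum_permutations'Aux_ite x _ w _ fun v => firstNeg_congr,
    if_pos (firstNeg_cons_min n w), if_neg (not_firstNeg_cons_max n w)]
  have hiff := firstNeg_iff_not_firstPos (mem_RB.1 hw).1
  by_cases h : FirstPos w
  · have h' : ¬ FirstNeg w := fun h' => hiff.1 h' h
    simp only [if_pos h, if_neg h', weight_cons_min hw h, add_zero, zero_add]
  · have h' := hiff.2 h
    simp only [if_neg h, if_pos h', weight_cons_max hw h', insertSum_max_of_mem_RB hw,
      insertSum_min_of_mem_RB hw, startDesc_zero_of_firstNeg h']
    push_cast
    ring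

end

open Polynomial

/-- `R⁺_n` as a complex polynomial. -/
noncomputable def RplusC (n : ℕ) : ℂ[X] := (Rplus n).map (algebraMap ℕ ℂ)

/-- `R⁻_n` as a complex polynomial. -/
noncomputable def RminusC (n : ℕ) : ℂ[X] := (Rminus n).map (algebraMap ℕ ℂ)

open Classical in
theorem RplusC_eq_sum (n : ℕ) : RplusC n = ∑ w ∈ (RB n).filter FirstPos, X ^ desB w := by
  simp [RplusC, Rplus, Polynomial.map_sum]

open Classical in
theorem RminusC_eq_sum (n : ℕ) : RminusC n = ∑ w ∈ (RB n).filter FirstNeg, X ^ desB w := by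
  simp [RminusC, Rminus, Polynomial.map_sum]

open Classical in
theorem RminusC_eq_sum_not (n : ℕ) :
    RminusC n = ∑ w ∈ (RB n).filter (fun w => ¬ FirstPos w), X ^ desB w := by
  rw [RminusC_eq_sum]
  congr 1
  exact Finset.filter_congr fun w hw => firstNeg_iff_not_firstPos (mem_RB.1 hw).1

theorem X_mul_derivative_X_pow (k : ℕ) :
    X * derivative (X ^ k : ℂ[X]) = (k : ℂ[X]) * X ^ k := by
  cases k with
  | zero => simp
  | succ k =>
    rw [derivative_X_pow]
    simp only [map_natCast, Nat.add_sub_cancel]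
    ring

theorem RplusC_succ (n : ℕ) :
    RplusC (n + 1) = (1 + 2 * (n : ℂ[X]) * X) * RplusC n +
      2 * (1 - 2 * X) * (X * derivative (RplusC n)) + RminusC n := by
  classical
  rw [RplusC_eq_sum (n + 1), sum_RB_succ,
    Finset.sum_congr rfl fun w hw => sum_insertions_firstPos hw _, Finset.sum_ite,
    ← RminusC_eq_sum_not, RplusC_eq_sum n, derivative_sum, Finset.mul_sum, Finset.mul_sum,
    Finset.mul_sum, ← Finset.sum_add_distrib]
  refine congrArg₂ (· + ·) (Finset.sum_congr rfl fun w _ => ?_) rfl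
  rw [X_mul_derivative_X_pow]
  ring

theorem RminusC_succ (n : ℕ) :
    RminusC (n + 1) = 2 * ((n : ℂ[X]) + 1) * X * RminusC n +
      2 * (1 - 2 * X) * (X * derivative (RminusC n)) + X * RplusC n := by
  classical
  rw [RminusC_eq_sum (n + 1), sum_RB_succ,
    Finset.sum_congr rfl fun w hw => sum_insertions_firstNeg hw _, Finset.sum_ite, add_comm,
    RminusC_eq_sum_not n, RplusC_eq_sum n, derivative_sum, Finset.mul_sum, Finset.mul_sum,
    Finset.mul_sum, Finset.mul_sum, ← Finset.sum_add_distrib]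
  refine congrArg₂ (· + ·) (Finset.sum_congr rfl fun w _ => ?_) ?_
  · rw [X_mul_derivative_X_pow]
    ring
  · exact Finset.sum_congr rfl fun w _ => pow_succ' _ _

theorem RB_zero : RB 0 = {[]} := by
  ext w
  rw [mem_RB, Finset.mem_singleton]
  constructor
  · rintro ⟨h, -⟩
    exact List.length_eq_zero_iff.1 h.length_eq
  · rintro rfl
    exact ⟨by simp [IsSignedPerm], fun k => by simp⟩

theorem RplusC_zero : RplusC 0 = 1 := by
  classical
  rw [RplusC_eq_sum, RB_zero, Finset.sum_filter, Finset.sum_singleton, if_pos (by simp [FirstPos])]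
  simp [desB]

theorem RminusC_zero : RminusC 0 = 0 := by
  classical
  rw [RminusC_eq_sum, RB_zero, Finset.sum_filter, Finset.sum_singleton,
    if_neg (by simp [FirstNeg])]

theorem aeval_Rplus (n : ℕ) (x : ℂ) : aeval x (Rplus n) = (RplusC n).eval x :=
  (eval_map_algebraMap _ _).symm

theorem aeval_Rminus (n : ℕ) (x : ℂ) : aeval x (Rminus n) = (RminusC n).eval x :=
  (eval_map_algebraMap _ _).symm

end SignedSimsun

namespace SignedSimsun

/-! ### A family of functions whose derivatives are governed by the recurrence -/

section Kernel

open Complex Polynomial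

/-- The half-angle tangent `sin s / (1 + cos s)`. -/
noncomputable def halfTan (s : ℂ) : ℂ := sin s / (1 + cos s)

/-- `tan (s / 2) ^ c / sin s`. -/
noncomputable def kernelP (c s : ℂ) : ℂ := halfTan s ^ c / sin s

/-- The companion of `kernelP`. -/
noncomputable def kernelQ (c s : ℂ) : ℂ := -2 * c * cos s * kernelP c s

/-- `1 / (2 cos² s)`. -/
noncomputable def halfSecSq (s : ℂ) : ℂ := 1 / (2 * cos s ^ 2)

theorem sin_ne_zero_of_halfTan {s : ℂ} (h : halfTan s ∈ slitPlane) : sin s ≠ 0 := by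
  intro h0
  exact slitPlane_ne_zero h (by simp [halfTan, h0])

theorem one_add_cos_ne_zero_of_halfTan {s : ℂ} (h : halfTan s ∈ slitPlane) : 1 + cos s ≠ 0 := by
  intro h0
  exact slitPlane_ne_zero h (by simp [halfTan, h0])

theorem hasDerivAt_halfTan {s : ℂ} (h : halfTan s ∈ slitPlane) :
    HasDerivAt halfTan (halfTan s / sin s) s := by
  have h1 := one_add_cos_ne_zero_of_halfTan h
  have h2 := sin_ne_zero_of_halfTan h
  refine ((hasDerivAt_sin s).div ((hasDerivAt_cos s).const_add 1) h1).congr_deriv ?_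
  rw [halfTan]
  field_simp
  linear_combination sin_sq_add_cos_sq s

theorem hasDerivAt_kernelP (c : ℂ) {s : ℂ} (h : halfTan s ∈ slitPlane) :
    HasDerivAt (kernelP c) ((c - cos s) / sin s * kernelP c s) s := by
  have h2 := sin_ne_zero_of_halfTan h
  have h3 := slitPlane_ne_zero h
  refine (((hasDerivAt_halfTan h).cpow_const (c := c) h).div (hasDerivAt_sin s) h2).congr_deriv ?_
  rw [kernelP, cpow_sub _ _ h3, cpow_one]
  field_simp

variable {c s : ℂ}

/-- The form is chosen to close the system: up to the factor -cot s, the derivatives of `kernelP`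
and `kernelQ` are combinations of the two with coefficients polynomial in `halfSecSq`. -/
theorem hasDerivAt_kernelP_eq (h : halfTan s ∈ slitPlane) (hc : cos s ≠ 0) :
    HasDerivAt (kernelP c)
      (-(cos s / sin s) * (kernelP c s + halfSecSq s * kernelQ c s)) s := by
  have h2 := sin_ne_zero_of_halfTan h
  refine (hasDerivAt_kernelP c h).congr_deriv ?_
  rw [kernelQ, halfSecSq]
  field_simp
  ring

theorem hasDerivAt_kernelQ_eq (h : halfTan s ∈ slitPlane) (hc : cos s ≠ 0)
    (h2c : 2 * c ^ 2 = 1) :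
    HasDerivAt (kernelQ c)
      (-(cos s / sin s) * (kernelP c s + 2 * halfSecSq s * kernelQ c s)) s := by
  have h2 := sin_ne_zero_of_halfTan h
  refine (((hasDerivAt_cos s).const_mul (-2 * c)).mul (hasDerivAt_kernelP c h)).congr_deriv ?_
  rw [kernelQ, halfSecSq]
  field_simp
  linear_combination (-cos s * kernelP c s) * h2c +
    (2 * c * kernelP c s) * sin_sq_add_cos_sq s

theorem hasDerivAt_halfSecSq (hs : sin s ≠ 0) (hc : cos s ≠ 0) :
    HasDerivAt halfSecSq
      (-(cos s / sin s) * (2 * halfSecSq s * (1 - 2 * halfSecSq s))) s := by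
  have hd : 2 * cos s ^ 2 ≠ 0 := by simp [hc]
  refine ((hasDerivAt_const s (1 : ℂ)).div (((hasDerivAt_cos s).pow 2).const_mul 2)
    hd).congr_deriv ?_
  rw [halfSecSq]
  simp only [Pi.pow_apply]
  field_simp
  push_cast
  linear_combination (2 * cos s) * sin_sq_add_cos_sq s

theorem hasDerivAt_cot (hs : sin s ≠ 0) (hc : cos s ≠ 0) :
    HasDerivAt (fun s => cos s / sin s) (-(cos s / sin s) ^ 2 * (2 * halfSecSq s)) s := by
  refine ((hasDerivAt_cos s).div (hasDerivAt_sin s) hs).congr_deriv ?_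
  rw [halfSecSq]
  field_simp
  linear_combination -sin_sq_add_cos_sq s

theorem hasDerivAt_cot_pow (n : ℕ) (hs : sin s ≠ 0) (hc : cos s ≠ 0) :
    HasDerivAt (fun s => (cos s / sin s) ^ n)
      (-(cos s / sin s) ^ (n + 1) * (n * (2 * halfSecSq s))) s := by
  refine ((hasDerivAt_cot hs hc).pow n).congr_deriv ?_
  cases n with
  | zero => simp
  | succ n =>
    simp only [Nat.add_sub_cancel]
    ring

/-- Up to sign, the `n`-th derivative of `kernelP c`. -/
noncomputable def kernelDeriv (c : ℂ) (n : ℕ) (s : ℂ) : ℂ :=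
  (cos s / sin s) ^ n * ((RplusC n).eval (halfSecSq s) * kernelP c s +
    (RminusC n).eval (halfSecSq s) * kernelQ c s)

theorem hasDerivAt_kernelDeriv (n : ℕ) (h : halfTan s ∈ slitPlane) (hc : cos s ≠ 0)
    (h2c : 2 * c ^ 2 = 1) :
    HasDerivAt (kernelDeriv c n) (-kernelDeriv c (n + 1) s) s := by
  have hs := sin_ne_zero_of_halfTan h
  have hX := hasDerivAt_halfSecSq hs hc
  have hp := ((RplusC n).hasDerivAt (halfSecSq s)).comp s hX
  have hm := ((RminusC n).hasDerivAt (halfSecSq s)).comp s hX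
  refine ((hasDerivAt_cot_pow n hs hc).mul ((hp.mul (hasDerivAt_kernelP_eq (c := c) h hc)).add
    (hm.mul (hasDerivAt_kernelQ_eq h hc h2c)))).congr_deriv ?_
  -- The power of the cotangent yields the terms 2nX, the chain rule the terms 2X(1 - 2X)R', and the
  -- system for P and Q the coupling between R⁺ and R⁻.
  rw [kernelDeriv, RplusC_succ, RminusC_succ]
  simp only [eval_add, eval_mul, eval_sub, eval_one, eval_ofNat, eval_natCast, eval_X,
    Function.comp_apply, Pi.add_apply, Pi.mul_apply]
  ring

theorem kernelDeriv_zero (c : ℂ) : kernelDeriv c 0 = kernelP c := by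
  ext s
  simp [kernelDeriv, RplusC_zero, RminusC_zero]

-- Equality holds near 0, not only at 0, so that the induction can differentiate it. The sign in
-- `hasDerivAt_kernelDeriv` cancels against the inner derivative `-y`.
open Topology in
theorem iteratedDeriv_kernelP_comp (n : ℕ) {α y : ℂ} (h : halfTan α ∈ slitPlane)
    (hc : cos α ≠ 0) (h2c : 2 * c ^ 2 = 1) :
    iteratedDeriv n (fun t => kernelP c (α - t * y)) =ᶠ[𝓝 0]
      fun t => y ^ n * kernelDeriv c n (α - t * y) := by
  have hcont : ContinuousAt (fun t : ℂ => α - t * y) 0 := by fun_prop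
  have hα : α - 0 * y = α := by simp
  have ev : ∀ᶠ t in 𝓝 (0 : ℂ), halfTan (α - t * y) ∈ slitPlane ∧ cos (α - t * y) ≠ 0 := by
    have e1 : ∀ᶠ s in 𝓝 α, halfTan s ∈ slitPlane :=
      (hasDerivAt_halfTan h).continuousAt.eventually (isOpen_slitPlane.mem_nhds h)
    have e2 : ∀ᶠ s in 𝓝 α, cos s ≠ 0 := continuous_cos.continuousAt.eventually_ne hc
    exact hcont.eventually (by simpa only [hα] using e1.and e2)
  induction n with
  | zero => simp [kernelDeriv_zero]
  | succ n ih =>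
    rw [iteratedDeriv_succ]
    refine ih.deriv.trans ?_
    filter_upwards [ev] with t ht
    have h1 : HasDerivAt (fun t : ℂ => α - t * y) (-y) t := by
      simpa using ((hasDerivAt_id t).mul_const y).const_sub α
    have h2 := ((hasDerivAt_kernelDeriv n ht.1 ht.2 h2c).comp t h1).const_mul (y ^ n)
    refine h2.deriv.trans ?_
    ring

theorem hasSum_kernelP {α y x : ℂ} (hy : y ≠ 0)
    (hα : ∀ s : ℂ, ‖s - α‖ < ‖α‖ → halfTan s ∈ slitPlane)
    (hα0 : α ≠ 0) (hc : cos α ≠ 0) (hsin : sin α = y * cos α) (hx : 2 * x - 1 = y ^ 2)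
    (h2c : 2 * c ^ 2 = 1) {t : ℂ} (ht : ‖t‖ * ‖y‖ < ‖α‖) :
    HasSum (fun n : ℕ => ((RplusC n).eval x * kernelP c α + (RminusC n).eval x * kernelQ c α) *
      (t ^ n / (n.factorial : ℂ))) (kernelP c (α - t * y)) := by
  have hslit : halfTan α ∈ slitPlane := hα α (by simpa using hα0)
  have hy' : 0 < ‖y‖ := norm_pos_iff.2 hy
  have hdiff : DifferentiableOn ℂ (fun t => kernelP c (α - t * y))
      (Metric.ball 0 (‖α‖ / ‖y‖)) := by
    intro t ht
    rw [mem_ball_zero_iff, lt_div_iff₀ hy'] at ht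
    have hs : halfTan (α - t * y) ∈ slitPlane := hα _ (by simpa using ht)
    have h1 : DifferentiableAt ℂ (fun t : ℂ => α - t * y) t := by fun_prop
    exact ((hasDerivAt_kernelP c hs).differentiableAt.comp t h1).differentiableWithinAt
  have hmem : t ∈ Metric.ball (0 : ℂ) (‖α‖ / ‖y‖) := by
    rwa [mem_ball_zero_iff, lt_div_iff₀ hy']
  -- As tan α = y, one has 1/cos² α = 1 + y² = 2x.
  have hX : halfSecSq α = x := by
    rw [halfSecSq]
    field_simp
    have h1 := sin_sq_add_cos_sq α
    rw [hsin] at h1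
    linear_combination -h1 - cos α ^ 2 * hx
  have hK : y * (cos α / sin α) = 1 := by
    rw [hsin]
    field_simp
  refine (hasSum_taylorSeries_on_ball hdiff hmem).congr_fun ?_
  intro n
  rw [(iteratedDeriv_kernelP_comp n hslit hc h2c).eq_of_nhds]
  simp only [kernelDeriv, zero_mul, sub_zero, hX, smul_eq_mul]
  rw [← mul_assoc (y ^ n), ← mul_pow, hK, one_pow]
  ring

theorem hasSum_of_hasSum_of_eq {ι M : Type*} [AddCommMonoid M] [TopologicalSpace M]
    {f : ι → M} {a b : M} (h : HasSum f a) (hab : a = b) : HasSum f b := hab ▸ h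

/-- After division by `kernelP (±c) α`, the two expansions have coefficients R⁺ ∓ 2c cos α · R⁻;
half their sum and a multiple of their difference isolate R⁺ and R⁻. -/
theorem hasSum_eval_RplusC_RminusC {α y x : ℂ} (hy : y ≠ 0)
    (hα : ∀ s : ℂ, ‖s - α‖ < ‖α‖ → halfTan s ∈ slitPlane)
    (hα0 : α ≠ 0) (hc : cos α ≠ 0) (hsin : sin α = y * cos α) (hx : 2 * x - 1 = y ^ 2)
    (h2c : 2 * c ^ 2 = 1) {t : ℂ} (ht : ‖t‖ * ‖y‖ < ‖α‖) :
    HasSum (fun n : ℕ => (RplusC n).eval x * (t ^ n / (n.factorial : ℂ)))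
      ((kernelP c (α - t * y) / kernelP c α + kernelP (-c) (α - t * y) / kernelP (-c) α) / 2) ∧
    HasSum (fun n : ℕ => (RminusC n).eval x * (t ^ n / (n.factorial : ℂ)))
      ((kernelP (-c) (α - t * y) / kernelP (-c) α - kernelP c (α - t * y) / kernelP c α) /
        (4 * c * cos α)) := by
  have hslit : halfTan α ∈ slitPlane := hα α (by simpa using hα0)
  have hP : ∀ c, kernelP c α ≠ 0 := fun c =>
    div_ne_zero (by simp [cpow_eq_zero_iff, slitPlane_ne_zero hslit])
      (sin_ne_zero_of_halfTan hslit)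
  have h1 := hasSum_kernelP hy hα hα0 hc hsin hx h2c ht
  have h2 := hasSum_kernelP hy hα hα0 hc hsin hx (c := -c) (by simpa using h2c) ht
  have hc0 : c ≠ 0 := by
    rintro rfl
    simp at h2c
  have hPc := hP c
  have hPnc := hP (-c)
  constructor
  · have h := (h1.mul_left (1 / (2 * kernelP c α))).add (h2.mul_left (1 / (2 * kernelP (-c) α)))
    refine hasSum_of_hasSum_of_eq (h.congr_fun fun n => ?_) ?_
    · simp only [kernelQ]
      field_simp
      ring
    · field_simp
  · have h := (h2.mul_left (1 / (4 * c * cos α * kernelP (-c) α))).sub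
      (h1.mul_left (1 / (4 * c * cos α * kernelP c α)))
    refine hasSum_of_hasSum_of_eq (h.congr_fun fun n => ?_) ?_
    · simp only [kernelQ]
      field_simp
      ring
    · field_simp

end Kernel

end SignedSimsun

/-! ### Branch cuts: the half-angle tangent, arctan and principal roots -/

namespace SignedSimsun

open Complex

theorem cos_add_cosh_pos {s : ℂ} (h : s.im ≠ 0 ∨ 0 < Real.sin s.re) :
    0 < Real.cos s.re + Real.cosh s.im := by
  have h1 := Real.neg_one_le_cos s.re
  have h2 := Real.one_le_cosh s.im
  rcases h with h | h
  · have := Real.one_lt_cosh.2 h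
    linarith
  · have : Real.cos s.re ≠ -1 := fun h' => by
      have := Real.sin_sq_add_cos_sq s.re
      rw [h'] at this
      nlinarith
    have := lt_of_le_of_ne h1 this.symm
    linarith

theorem sin_re_im (s : ℂ) : (sin s).re = Real.sin s.re * Real.cosh s.im ∧
    (sin s).im = Real.cos s.re * Real.sinh s.im := by
  rw [sin_eq, ← ofReal_sin, ← ofReal_cos, ← ofReal_sinh, ← ofReal_cosh]
  simp only [add_re, add_im, mul_re, mul_im, ofReal_re, ofReal_im, I_re, I_im]
  constructor <;> ring

theorem cos_re_im (s : ℂ) : (cos s).re = Real.cos s.re * Real.cosh s.im ∧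
    (cos s).im = -(Real.sin s.re * Real.sinh s.im) := by
  rw [cos_eq, ← ofReal_sin, ← ofReal_cos, ← ofReal_sinh, ← ofReal_cosh]
  simp only [mul_re, mul_im, sub_re, sub_im, ofReal_re, ofReal_im, I_re, I_im]
  constructor <;> ring

theorem normSq_one_add_cos (s : ℂ) :
    normSq (1 + cos s) = (Real.cos s.re + Real.cosh s.im) ^ 2 := by
  rw [normSq_apply, add_re, add_im, (cos_re_im s).1, (cos_re_im s).2, one_re, one_im]
  linear_combination (Real.sinh s.im ^ 2) * Real.sin_sq_add_cos_sq s.re +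
    (Real.cos s.re ^ 2 - 1) * Real.cosh_sq s.im

theorem halfTan_re_im {s : ℂ} (h : s.im ≠ 0 ∨ 0 < Real.sin s.re) :
    (halfTan s).re = Real.sin s.re / (Real.cos s.re + Real.cosh s.im) ∧
      (halfTan s).im = Real.sinh s.im / (Real.cos s.re + Real.cosh s.im) := by
  have hD := (cos_add_cosh_pos h).ne'
  rw [halfTan, div_re, div_im, normSq_one_add_cos, add_re, add_im, (cos_re_im s).1,
    (cos_re_im s).2, one_re, one_im, (sin_re_im s).1, (sin_re_im s).2]
  constructor
  · field_simp
    linear_combination (Real.sin s.re * Real.cos s.re) * Real.cosh_sq s.im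
  · field_simp
    linear_combination (Real.sinh s.im * Real.cosh s.im) * Real.sin_sq_add_cos_sq s.re

theorem halfTan_mem_slitPlane {s : ℂ} (h : s.im ≠ 0 ∨ 0 < Real.sin s.re) :
    halfTan s ∈ slitPlane := by
  have hD := cos_add_cosh_pos h
  rw [mem_slitPlane_iff, (halfTan_re_im h).1, (halfTan_re_im h).2]
  rcases h with h | h
  · exact Or.inr (div_ne_zero (by simpa using h) hD.ne')
  · exact Or.inl (div_pos h hD)

theorem halfTan_mem_slitPlane_of_norm_sub_lt {α s : ℂ} (h0 : 0 < α.re) (h1 : α.re < Real.pi / 2)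
    (hs : ‖s - α‖ < ‖α‖) : halfTan s ∈ slitPlane := by
  apply halfTan_mem_slitPlane
  by_cases hi : s.im = 0
  · refine Or.inr ?_
    have h2 : ‖s - α‖ ^ 2 < ‖α‖ ^ 2 := by gcongr
    rw [← normSq_eq_norm_sq, ← normSq_eq_norm_sq, normSq_apply, normSq_apply, sub_re, sub_im,
      hi] at h2
    -- On the real axis the disc condition reads s² < 2s · Re α, that is 0 < s < 2 Re α < π.
    have h3 : s.re * s.re < 2 * α.re * s.re := by nlinarith
    have h4 : 0 < s.re := by
      by_contra! h
      nlinarith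
    have h5 : s.re < 2 * α.re := lt_of_mul_lt_mul_right h3 h4.le
    exact Real.sin_pos_of_pos_of_lt_pi h4 (by linarith)
  · exact Or.inl hi

/-- Re arctan y is half the argument of (1 + iy)/(1 - iy), which lies in the open upper half-plane
when Re y > 0. -/
theorem arctan_re_mem {y : ℂ} (hy : 0 < y.re) :
    0 < (arctan y).re ∧ (arctan y).re < Real.pi / 2 := by
  have hw : 0 < ((1 + y * I) / (1 - y * I)).im := by
    have hn : 0 < normSq (1 - y * I) := by
      refine normSq_pos.2 fun h => ?_
      have := congrArg im h
      simp at this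
      exact hy.ne' this
    rw [div_im, ← sub_div]
    refine div_pos ?_ hn
    simp
    nlinarith
  have hre : (arctan y).re = ((1 + y * I) / (1 - y * I)).arg / 2 := by
    simp only [arctan, mul_re, neg_re, neg_im, log_re, log_im, div_ofNat_re,
      div_ofNat_im, I_re, I_im]
    ring
  have h1 : ((1 + y * I) / (1 - y * I)).arg < Real.pi := arg_lt_pi_iff.2 (Or.inr hw.ne')
  have h2 : 0 ≤ ((1 + y * I) / (1 - y * I)).arg := arg_nonneg_iff.2 hw.le
  have h3 : ((1 + y * I) / (1 - y * I)).arg ≠ 0 := fun h => hw.ne' (arg_eq_zero_iff.1 h).2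
  have h4 := lt_of_le_of_ne h2 h3.symm
  rw [hre]
  constructor <;> linarith

theorem sqrt_sq_eq (z : ℂ) : Complex.sqrt z ^ 2 = z := by
  simp [Complex.sqrt]

theorem sqrt_re_pos {z : ℂ} (hz : z ∈ slitPlane) : 0 < (Complex.sqrt z).re := by
  rw [Complex.sqrt, cpow_inv_two_re]
  apply Real.sqrt_pos.2
  have : 0 < ‖z‖ + z.re := by
    rcases mem_slitPlane_iff.1 hz with h | h
    · positivity
    · have := abs_re_lt_norm.2 h
      linarith [neg_abs_le z.re]
  linarith

theorem eq_of_sq_eq_of_re_pos {a b : ℂ} (ha : 0 < a.re) (hb : 0 < b.re) (h : a ^ 2 = b ^ 2) :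
    a = b := by
  rcases sq_eq_sq_iff_eq_or_eq_neg.1 h with h | h
  · exact h
  · rw [h, neg_re] at ha
    linarith

theorem inv_re_pos {a : ℂ} (ha : 0 < a.re) : 0 < (a⁻¹).re := by
  rw [inv_re]
  refine div_pos ha (normSq_pos.2 ?_)
  rintro rfl
  simp at ha

/-- Since |arg a| < π/2, the number -2 log a stays in the principal strip and no branch jump occurs.
-/
theorem sq_inv_cpow {a : ℂ} (ha : 0 < a.re) (c : ℂ) : ((a ^ 2)⁻¹) ^ c = a ^ (-(2 * c)) := by
  have harg := abs_lt.1 (abs_arg_lt_pi_div_two_iff.2 (Or.inl ha))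
  have him : (log a * (-2)).im = -2 * a.arg := by simp [log_im, mul_comm]
  have h := cpow_mul (x := a) (y := -2) c (by rw [him]; linarith) (by rw [him]; linarith)
  rw [cpow_neg, cpow_ofNat] at h
  rw [← h]
  ring_nf

theorem F₂_neg (s : ℂ) : F₂ (-s) = kernelP (1 / Complex.sqrt 2) s / Complex.sqrt 2 := by
  simp only [F₂, kernelP, halfTan, Complex.sin_neg, Complex.cos_neg, neg_neg]
  field_simp

theorem F₁_neg (s : ℂ) : F₁ (-s) = kernelP (-(1 / Complex.sqrt 2)) s / Complex.sqrt 2 := by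
  simp only [F₁, kernelP, halfTan, Complex.sin_neg, Complex.cos_neg, neg_neg]
  field_simp

end SignedSimsun

/-! ### Evaluation of the constants at α = arctan √(2x-1) -/

namespace SignedSimsun

open Complex

section Parameters

variable {x : ℂ}

theorem two_mul_mem_slitPlane (hx : 2 * x - 1 ∈ slitPlane) : 2 * x ∈ slitPlane := by
  rw [mem_slitPlane_iff] at hx ⊢
  rw [sub_re, sub_im, one_re, one_im, sub_zero] at hx
  exact hx.imp_left fun h => by linarith

theorem mem_slitPlane_of_two_mul (hx : 2 * x ∈ slitPlane) : x ∈ slitPlane := by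
  rw [mem_slitPlane_iff] at hx ⊢
  simpa using hx

/-- Both sides have the same square and positive real part, the factor √2 being a positive real. -/
theorem sqrt_two_mul (hx : 2 * x ∈ slitPlane) :
    Complex.sqrt (2 * x) = Complex.sqrt 2 * Complex.sqrt x := by
  have h2 : Complex.sqrt 2 = (Real.sqrt 2 : ℝ) :=
    eq_of_sq_eq_of_re_pos (sqrt_re_pos (by simp)) (by simp)
      (by rw [sqrt_sq_eq, ← ofReal_pow, Real.sq_sqrt zero_le_two, ofReal_ofNat])
  refine eq_of_sq_eq_of_re_pos (sqrt_re_pos hx) ?_ (by simp only [mul_pow, sqrt_sq_eq])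
  rw [h2, re_ofReal_mul]
  exact mul_pos (by positivity) (sqrt_re_pos (mem_slitPlane_of_two_mul hx))

theorem sin_arctan_eq {y : ℂ} (hy : 0 < y.re) : cos (arctan y) ≠ 0 ∧
    sin (arctan y) = y * cos (arctan y) := by
  have hI : y ≠ I := by
    rintro rfl
    simp at hy
  have hI' : y ≠ -I := by
    rintro rfl
    simp at hy
  have hy0 : y ≠ 0 := by
    rintro rfl
    simp at hy
  have h := tan_arctan hI hI'
  have hc : cos (arctan y) ≠ 0 := fun h0 => hy0 (by rw [← h, tan_eq_sin_div_cos, h0, div_zero])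
  refine ⟨hc, ?_⟩
  rw [tan_eq_sin_div_cos, div_eq_iff hc] at h
  exact h

theorem cos_arctan_sqrt (hx : 2 * x - 1 ∈ slitPlane) :
    cos (arctan (Complex.sqrt (2 * x - 1))) = (Complex.sqrt (2 * x))⁻¹ := by
  have hy := sqrt_re_pos hx
  obtain ⟨h1, h2⟩ := arctan_re_mem hy
  have hρ := sqrt_re_pos (two_mul_mem_slitPlane hx)
  refine eq_of_sq_eq_of_re_pos ?_ (inv_re_pos hρ) ?_
  · rw [(cos_re_im _).1]
    exact mul_pos (Real.cos_pos_of_mem_Ioo ⟨by linarith, h2⟩) (Real.cosh_pos _)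
  · have h := sin_sq_add_cos_sq (arctan (Complex.sqrt (2 * x - 1)))
    rw [(sin_arctan_eq hy).2, mul_pow, sqrt_sq_eq] at h
    rw [inv_pow, sqrt_sq_eq]
    refine eq_inv_of_mul_eq_one_left ?_
    linear_combination h

/-- With cos α = 1/√(2x), the base of p(x) is (1 + cos α)/(1 - cos α) = tan(α/2)⁻². Since tan(α/2)
has positive real part, the exponents may be multiplied. -/
theorem p_eq (hx : 2 * x - 1 ∈ slitPlane) :
    p x = halfTan (arctan (Complex.sqrt (2 * x - 1))) ^ (-(1 / Complex.sqrt 2)) := by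
  have hy := sqrt_re_pos hx
  obtain ⟨h1, h2⟩ := arctan_re_mem hy
  have hsin : 0 < Real.sin (arctan (Complex.sqrt (2 * x - 1))).re :=
    Real.sin_pos_of_pos_of_lt_pi h1 (by linarith [Real.pi_pos])
  have hτ : 0 < (halfTan (arctan (Complex.sqrt (2 * x - 1)))).re := by
    rw [(halfTan_re_im (Or.inr hsin)).1]
    exact div_pos hsin (cos_add_cosh_pos (Or.inr hsin))
  have hρ := sqrt_re_pos (two_mul_mem_slitPlane hx)
  have hρ0 : Complex.sqrt (2 * x) ≠ 0 := by
    intro h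
    simp [h] at hρ
  have hρ1 : Complex.sqrt (2 * x) + 1 ≠ 0 := by
    intro h
    have := congrArg re h
    simp at this
    linarith
  have hy0 : Complex.sqrt (2 * x - 1) ≠ 0 := by
    intro h
    simp [h] at hy
  have hρsq := sqrt_sq_eq (2 * x)
  have hysq := sqrt_sq_eq (2 * x - 1)
  have hρ1' : Complex.sqrt (2 * x) - 1 ≠ 0 := by
    intro h
    apply slitPlane_ne_zero hx
    linear_combination (Complex.sqrt (2 * x) + 1) * h - hρsq
  have hbase : (Complex.sqrt (2 * x) + 1) / (Complex.sqrt (2 * x) - 1) =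
      (halfTan (arctan (Complex.sqrt (2 * x - 1))) ^ 2)⁻¹ := by
    rw [halfTan, (sin_arctan_eq hy).2, cos_arctan_sqrt hx]
    have : 1 + (Complex.sqrt (2 * x))⁻¹ = (Complex.sqrt (2 * x) + 1) / Complex.sqrt (2 * x) := by
      field_simp
    rw [this]
    field_simp
    rw [hysq]
    linear_combination -hρsq
  have h2 := sqrt_sq_eq 2
  have h20 : Complex.sqrt 2 ≠ 0 := by
    intro h
    simp [h] at h2
  rw [p, hbase, sq_inv_cpow hτ]
  congr 1
  field_simp
  linear_combination -2 * h2

end Parameters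

end SignedSimsun

theorem theorem1 (x t : ℂ) (hx : 2 * x - 1 ∈ Complex.slitPlane)
    (ht : ‖t‖ * ‖Complex.sqrt (2 * x - 1)‖ < ‖Complex.arctan (Complex.sqrt (2 * x - 1))‖) :
    HasSum (fun n : ℕ => Polynomial.aeval x (SignedSimsun.Rplus n) * (t ^ n / (n.factorial : ℂ)))
      (Complex.sqrt (2 * x - 1) / (2 * Complex.sqrt x * SignedSimsun.p x) *
        (SignedSimsun.p x ^ 2 * SignedSimsun.F₂ (SignedSimsun.u x t)
          + SignedSimsun.F₁ (SignedSimsun.u x t))) ∧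
    HasSum (fun n : ℕ => Polynomial.aeval x (SignedSimsun.Rminus n) * (t ^ n / (n.factorial : ℂ)))
      (-Complex.sqrt (2 * x - 1) / (2 * SignedSimsun.p x) *
        (SignedSimsun.p x ^ 2 * SignedSimsun.F₂ (SignedSimsun.u x t)
          - SignedSimsun.F₁ (SignedSimsun.u x t))) := by
  open SignedSimsun in
  have hy := sqrt_re_pos hx
  have hy0 : Complex.sqrt (2 * x - 1) ≠ 0 := by
    intro h
    simp [h] at hy
  have h2x := two_mul_mem_slitPlane hx
  have hsx : Complex.sqrt x ≠ 0 := by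
    have := sqrt_re_pos (mem_slitPlane_of_two_mul h2x)
    intro h
    simp [h] at this
  have h2 := sqrt_sq_eq 2
  have h20 : Complex.sqrt 2 ≠ 0 := by
    intro h
    simp [h] at h2
  obtain ⟨hα1, hα2⟩ := arctan_re_mem hy
  obtain ⟨hc, hsin⟩ := sin_arctan_eq hy
  have hcos := cos_arctan_sqrt hx
  have hp := p_eq hx
  -- The argument u is -(α - ty), so `F₂` and `F₁` at u are the kernels at α - ty divided by √2.
  have hu : u x t = -(Complex.arctan (Complex.sqrt (2 * x - 1)) -
      t * Complex.sqrt (2 * x - 1)) := by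
    rw [u]
    ring
  rw [hu, F₂_neg, F₁_neg]
  set y := Complex.sqrt (2 * x - 1) with hydef
  set α := Complex.arctan y with hα
  have hα0 : α ≠ 0 := by
    intro h
    simp [h] at hα1
  have hslit : ∀ s : ℂ, ‖s - α‖ < ‖α‖ → halfTan s ∈ Complex.slitPlane :=
    fun s hs => halfTan_mem_slitPlane_of_norm_sub_lt hα1 hα2 hs
  have hτ0 : halfTan α ≠ 0 := Complex.slitPlane_ne_zero (hslit α (by simpa using hα0))
  have hp0 : p x ≠ 0 := by
    rw [hp]
    simp [Complex.cpow_eq_zero_iff, hτ0]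
  have h2c : 2 * (1 / Complex.sqrt 2) ^ 2 = 1 := by
    field_simp
    exact h2.symm
  have hsinα : Complex.sin α = y / (Complex.sqrt 2 * Complex.sqrt x) := by
    rw [hsin, hcos, sqrt_two_mul h2x, div_eq_mul_inv]
  have hP2 : kernelP (-(1 / Complex.sqrt 2)) α = p x * (Complex.sqrt 2 * Complex.sqrt x) / y := by
    rw [kernelP, ← hp, hsinα, div_div_eq_mul_div]
  have hP1 : kernelP (1 / Complex.sqrt 2) α =
      (p x)⁻¹ * (Complex.sqrt 2 * Complex.sqrt x) / y := by
    rw [kernelP, hp, Complex.cpow_neg, inv_inv, hsinα, div_div_eq_mul_div]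
  obtain ⟨h1, h2'⟩ := hasSum_eval_RplusC_RminusC hy0 hslit hα0 hc hsin
    (sqrt_sq_eq (2 * x - 1)).symm h2c ht
  rw [hP1, hP2] at h1
  rw [hP1, hP2, hcos, sqrt_two_mul h2x] at h2'
  simp only [aeval_Rplus, aeval_Rminus]
  refine ⟨hasSum_of_hasSum_of_eq h1 ?_, hasSum_of_hasSum_of_eq h2' ?_⟩
  · field_simp
  · field_simp
    linear_combination 2 * (kernelP (-(1 / Complex.sqrt 2)) (α - t * y) -
      p x ^ 2 * kernelP (1 / Complex.sqrt 2) (α - t * y)) * h2
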